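/- Let $A\in\{0,\star\}^{d\times d}$ and $B\in\{0,\star\}^{d\times m}$ be sparsity matrices. A pair $(A,B)$ is \emph{structurally controllable} if real values can be assigned to the $\star$ entries of $A$ and $B$ (all other entries being $0$) so that the linear system $\dot x=A'x+B'u$ with the resulting matrices $(A',B')$ is controllable. Assume that $(A,B)$ is structurally controllable, and let each $\star$ entry $B_{ik}$ carry a cost $w_{ik}\ge 0$; put $w_{ik}=\infty$ if $B_{ik}=0$. Let $G(A)$ be the digraph on $\{v_1,\dots,v_d\}$ with an edge $(v_j,v_i)$ whenever $A_{ij}=\star$, and let $\Gamma(A)$ be the undirected bipartite graph with parts $\{v^1_1,\dots,v^1_d\}$ and $\{v^2_1,\dots,v^2_d\}$ and an edge $\{v^1_j,v^2_i\}$ whenever $A_{ij}=\star$. Assume that $\Gamma(A)$ has a perfect matching. Consider the following algorithm. List the source strongly connected components $\mathcal S_1,\dots,\mathcal S_q$ of $G(A)$ (the strongly connected components that no edge enters from outside), and start with $L=\emptyset$. For each $\mathcal S_j$ in turn: for each $v_i\in\mathcal S_j$ choose a smallest cost $w_{ik}$ among $w_{i1},\dots,w_{im}$; then choose $v_\ell\in\mathcal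 S_j$ for which this smallest cost, say $w_{\ell k}$, is least, and add $(\ell,k)$ to $L$. Output $B^*\in\{0,\star\}^{d\times m}$ with $B^*_{\ell k}=\star$ if $(\ell,k)\in L$ and $B^*_{\ell k}=0$ otherwise. Ties and the order of the components are arbitrary. Let $\mathcal K$ be the set of all $B'\in\{0,\star\}^{d\times m}$ such that $B'_{ik}=0$ whenever $B_{ik}=0$ and $(A,B')$ is structurally controllable. Write $\|B'\|_0$ for the number of $\star$ entries of $B'$ and $\|B'\|_w=\sum_{(i,k):\,B'_{ik}=\star}w_{ik}$. Then the algorithm yields an output, and for every possible output $B^*$ the pair $(A,B^*)$ is structurally controllable and $B^*$ solves $$\min_{B'\in\mathcal K}\ \|B'\|_w\quad\text{subject to}\quad \|B'\|_0\le\|B''\|_0\ \text{ for all } B''\in\mathcal K,$$ that is, $B^*\in\mathcal K$, $B^*$ has the fewest $\star$ entries among all elements of $\mathcal K$, and it has minimum cost among all such sparsest elements. -/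

import Mathlib

namespace StructuralControl

/-- Sparsity matrices with entries in `{0, ⋆}`: the value `true` stands for a free entry `⋆`,
the value `false` for a fixed zero. -/
abbrev Sparsity (n k : ℕ) : Type := Matrix (Fin n) (Fin k) Bool

/-- `R` is a numerical realization of the sparsity matrix `N`: it vanishes at all fixed zeros,
and its values at the `⋆` entries are arbitrary real numbers. -/
def IsRealization {n k : ℕ} (N : Sparsity n k) (R : Matrix (Fin n) (Fin k) ℝ) : Prop :=
  ∀ i j, N i j = false → R i j = 0

/-- `x` is a trajectory of `x' = A x + B u` on the time interval `[0, T]`. -/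
def IsTrajectory {d m : ℕ} (A : Matrix (Fin d) (Fin d) ℝ) (B : Matrix (Fin d) (Fin m) ℝ)
    (T : ℝ) (u : ℝ → Fin m → ℝ) (x : ℝ → Fin d → ℝ) : Prop :=
  ∀ t ∈ Set.Icc 0 T,
    HasDerivWithinAt x (A.mulVec (x t) + B.mulVec (u t)) (Set.Icc 0 T) t

/-- Controllability of the linear time-invariant system `x' = A x + B u`: every initial state
can be steered to every final state in finite time by some continuous input. -/
def Controllable {d m : ℕ} (A : Matrix (Fin d) (Fin d) ℝ) (B : Matrix (Fin d) (Fin m) ℝ) : Prop :=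
  ∀ x₀ x₁ : Fin d → ℝ, ∃ T : ℝ, 0 < T ∧ ∃ (u : ℝ → Fin m → ℝ) (x : ℝ → Fin d → ℝ),
    ContinuousOn u (Set.Icc 0 T) ∧ IsTrajectory A B T u x ∧ x 0 = x₀ ∧ x T = x₁

/-- Structural controllability: some numerical realization is controllable. -/
def StructurallyControllable {d m : ℕ} (A : Sparsity d d) (B : Sparsity d m) : Prop :=
  ∃ (RA : Matrix (Fin d) (Fin d) ℝ) (RB : Matrix (Fin d) (Fin m) ℝ),
    IsRealization A RA ∧ IsRealization B RB ∧ Controllable RA RB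

/-- The digraph `G(A)` on the state vertices, with an edge from `j` to `i` iff `A i j = ⋆`. -/
def stateDigraph {d : ℕ} (A : Sparsity d d) : Digraph (Fin d) where
  Adj j i := A i j = true

/-- The subgraph of `G` induced on the vertex set `S` is strongly connected (every vertex of `S`
is joined to every vertex of `S` by a directed path inside `S`, possibly of length zero). -/
def IsStronglyConnectedOn {V : Type*} (G : Digraph V) (S : Finset V) : Prop :=
  ∀ a ∈ S, ∀ b ∈ S, Relation.ReflTransGen (fun p q => p ∈ S ∧ q ∈ S ∧ G.Adj p q) a b

/-- Strongly connected components, given by their vertex sets. -/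
def IsSCC {V : Type*} (G : Digraph V) (S : Finset V) : Prop :=
  Maximal (fun T : Finset V => T.Nonempty ∧ IsStronglyConnectedOn G T) S

/-- Source strongly connected components: no edge enters from outside. -/
def IsSourceSCC {V : Type*} (G : Digraph V) (S : Finset V) : Prop :=
  IsSCC G S ∧ ∀ a, a ∉ S → ∀ b ∈ S, ¬ G.Adj a b

/-- The undirected bipartite graph `Γ(A)`: the left copy of the state `j` is joined to the right
copy of the state `i` iff `A i j = ⋆`. -/
def bipartiteGraph {d : ℕ} (A : Sparsity d d) : SimpleGraph (Fin d ⊕ Fin d) :=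
  SimpleGraph.fromRel fun p q => ∃ i j, A i j = true ∧ p = Sum.inl j ∧ q = Sum.inr i

/-- `Γ(A)` has a perfect matching. -/
def HasPerfectMatching {d : ℕ} (A : Sparsity d d) : Prop :=
  ∃ M : (bipartiteGraph A).Subgraph, M.IsPerfectMatching

/-- The number of nonzero entries of a sparsity matrix. -/
def nnzCount {n k : ℕ} (N : Sparsity n k) : ℕ :=
  ∑ i, ∑ j, if N i j = true then 1 else 0

/-- The total cost of the nonzero entries of a sparsity matrix. -/
noncomputable def totalCost {n k : ℕ} (w : Matrix (Fin n) (Fin k) ℝ) (N : Sparsity n k) : ℝ :=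
  ∑ i, ∑ j, if N i j = true then w i j else 0

/-- The set of admissible input matrices: those whose zeros include all zeros of `B`
and that make the pair with `A` structurally controllable. -/
def admissible {d m : ℕ} (A : Sparsity d d) (B : Sparsity d m) : Set (Sparsity d m) :=
  {N | (∀ i j, B i j = false → N i j = false) ∧ StructurallyControllable A N}

/-- The admissible input matrices with the least number of nonzero entries. -/
def sparsestAdmissible {d m : ℕ} (A : Sparsity d d) (B : Sparsity d m) : Set (Sparsity d m) :=
  {N | N ∈ admissible A B ∧ ∀ N₂ ∈ admissible A B, nnzCount N ≤ nnzCount N₂}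

/-- `N` has minimum cost among the sparsest admissible input matrices. -/
def SolvesP2 {d m : ℕ} (A : Sparsity d d) (B : Sparsity d m) (w : Matrix (Fin d) (Fin m) ℝ)
    (N : Sparsity d m) : Prop :=
  N ∈ sparsestAdmissible A B ∧ ∀ N₂ ∈ sparsestAdmissible A B, totalCost w N ≤ totalCost w N₂

/-- The costs seen by the algorithm: `∞` for the input-connections that are absent from `B`. -/
noncomputable def extCost {d m : ℕ} (B : Sparsity d m) (w : Matrix (Fin d) (Fin m) ℝ)
    (i : Fin d) (k : Fin m) : WithTop ℝ :=
  if B i k = true then (w i k : WithTop ℝ) else ⊤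

/-- One pass of the loop body on the component `S` may select the connection from the input `k`
to the state `l`: for each state `i ∈ S` a cheapest input `best i` is chosen, and then a state
`l ∈ S` for which this smallest cost is least; ties are broken arbitrarily. -/
def Selects {d m : ℕ} (B : Sparsity d m) (w : Matrix (Fin d) (Fin m) ℝ) (S : Finset (Fin d))
    (k : Fin m) (l : Fin d) : Prop :=
  ∃ best : Fin d → Fin m,
    (∀ i ∈ S, ∀ k₂, extCost B w i (best i) ≤ extCost B w i k₂) ∧
    l ∈ S ∧ (∀ i ∈ S, extCost B w l (best l) ≤ extCost B w i (best i)) ∧ k = best l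

/-- `LoopRun B w comps L L₂`: the loop over the components `comps`, started with the set `L` of
input-connections, may end with the set `L₂`. -/
inductive LoopRun {d m : ℕ} (B : Sparsity d m) (w : Matrix (Fin d) (Fin m) ℝ) :
    List (Finset (Fin d)) → Finset (Fin m × Fin d) → Finset (Fin m × Fin d) → Prop
  | done (L : Finset (Fin m × Fin d)) : LoopRun B w [] L L
  | step (S : Finset (Fin d)) (comps : List (Finset (Fin d))) (k : Fin m) (l : Fin d)
      (L L₂ : Finset (Fin m × Fin d)) (hsel : Selects B w S k l)
      (hrun : LoopRun B w comps (insert (k, l) L) L₂) : LoopRun B w (S :: comps) L L₂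

/-- `N` is a possible output of the greedy algorithm on the input `A`, `B`, `w`: the source
strongly connected components of `G(A)` are listed in some order, the loop is run on this list
starting with the empty set, and `N` has its `⋆` entries at the selected connections. -/
def IsAlgorithmOutput {d m : ℕ} (A : Sparsity d d) (B : Sparsity d m)
    (w : Matrix (Fin d) (Fin m) ℝ) (N : Sparsity d m) : Prop :=
  ∃ (comps : List (Finset (Fin d))) (L : Finset (Fin m × Fin d)),
    comps.Nodup ∧ (∀ S, S ∈ comps ↔ IsSourceSCC (stateDigraph A) S) ∧
    LoopRun B w comps ∅ L ∧ ∀ l k, N l k = true ↔ (k, l) ∈ L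

end StructuralControl

namespace StructuralControl

/-! Everything rests on a criterion: when `Γ(A)` has a perfect matching, `(A, N)` is structurally
controllable iff `N` feeds every source component. Necessity: the states of an unfed source
component obey a closed linear ODE, so they stay at zero (`StructurallyControllable.exists_input`).
Sufficiency (`structurallyControllable_of_input`): the matching is a permutation `σ` along edges of
`G(A)`, so its cycles cover all states. Since every state is reachable from a fed state, each cycle
can be given one entering edge, from an input or from a cycle nearer to the inputs; this makes the
cycles a forest. Put distinct positive weights on the cycles and weight 1 on the entering edges. By
`eq_zero_of_forest_eigenvector` no left eigenvector of this realization is annihilated by the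
inputs, and the eigenvector test gives controllability. Source components are disjoint, so an
admissible matrix has at least one entry per source component, and since costs are nonnegative it
costs at least the sum of the cheapest entries. The greedy choice attains both bounds. -/

/-! ### Left eigenvectors of weighted cycles joined along a forest. -/

open Equiv.Perm in
/-- A property that spreads along the cycle of `p`, starting right after `p` and ending at `p`,
holds on the whole cycle. -/
theorem forall_sameCycle_of_step {V : Type*} [Finite V] (σ : Equiv.Perm V) (p : V) (P : V → Prop)
    (h0 : P (σ p)) (hstep : ∀ j, σ.SameCycle p j → j ≠ p → P j → P (σ j)) :
    ∀ j, σ.SameCycle p j → P j := by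
  have key : ∀ n : ℕ, P ((σ ^ (n + 1)) p) := by
    intro n
    induction n with
    | zero => simpa using h0
    | succ n ih =>
      have e : (σ ^ (n + 1 + 1)) p = σ ((σ ^ (n + 1)) p) := by
        rw [pow_succ' σ (n + 1)]; rfl
      rw [e]
      by_cases hp : (σ ^ (n + 1)) p = p
      · rw [hp]; exact h0
      · exact hstep _ (sameCycle_pow_right.2 (SameCycle.refl σ p)) hp ih
  intro j hj
  obtain ⟨n, hn, -, rfl⟩ := hj.exists_pow_eq''
  obtain ⟨k, rfl⟩ : ∃ k, n = k + 1 := ⟨n - 1, by omega⟩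
  exact key k

open Equiv.Perm in
/-- If a function on a cycle is multiplied at each step by `μ / c`, then `‖μ‖ = c` unless
the function vanishes. -/
theorem norm_eq_of_cycle_relation {V : Type*} [Finite V] (σ : Equiv.Perm V) (v : V → ℂ) (c : ℝ)
    (hc : 0 < c) (μ : ℂ) (j₀ : V) (hv : v j₀ ≠ 0)
    (h : ∀ j, σ.SameCycle j₀ j → (c : ℂ) * v (σ j) = μ * v j) : ‖μ‖ = c := by
  have key : ∀ n : ℕ, (c : ℂ) ^ n * v ((σ ^ n) j₀) = μ ^ n * v j₀ := by
    intro n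
    induction n with
    | zero => simp
    | succ n ih =>
      have e : (σ ^ (n + 1)) j₀ = σ ((σ ^ n) j₀) := by
        rw [pow_succ' σ n]; rfl
      rw [e, pow_succ, mul_assoc, h _ (sameCycle_pow_right.2 (SameCycle.refl σ j₀)),
        mul_left_comm, ih]
      ring
  have hk := key (orderOf σ)
  rw [pow_orderOf_eq_one, one_apply] at hk
  have hk' := mul_right_cancel₀ hv hk
  have hn : c ^ orderOf σ = ‖μ‖ ^ orderOf σ := by
    have := congrArg norm hk'
    simpa [abs_of_pos hc] using this
  exact ((pow_left_inj₀ hc.le (norm_nonneg _) (orderOf_pos σ).ne').1 hn).symm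

open Equiv.Perm Relation in
/-- Cycles with pairwise distinct moduli, attached to each other and to the inputs along a forest,
admit no left eigenvector annihilated by the inputs. -/
theorem eq_zero_of_forest_eigenvector {V Q I : Type*} [Fintype V] [Fintype Q] [DecidableEq V]
    [DecidableEq I]
    (σ : Equiv.Perm V) (π : V → Q) (hπ : ∀ i j, π i = π j ↔ σ.SameCycle i j)
    (c : Q → ℝ) (hc : ∀ q, 0 < c q) (hcinj : Function.Injective c)
    (D : Q → ℕ) (t : Q → V) (ht : ∀ q, π (t q) = q) (src : Q → V ⊕ I)
    (hD : ∀ q p, src q = Sum.inl p → D (π p) < D q)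
    (v : V → ℂ) (μ : ℂ)
    (h1 : ∀ j, (c (π j) : ℂ) * v (σ j) + ∑ q, (if src q = Sum.inl j then v (t q) else 0) = μ * v j)
    (h2 : ∀ k, ∑ q, (if src q = Sum.inr k then v (t q) else 0) = 0) : v = 0 := by
  classical
  by_contra hv
  -- A cycle is live if `v` is not identically zero on it; `R a b` says that `b` is the parent of
  -- `a` in the forest.
  let live : Q → Prop := fun q => ∃ j, π j = q ∧ v j ≠ 0
  let R : Q → Q → Prop := fun a b => ∃ j, src a = Sum.inl j ∧ π j = b
  have hRD : ∀ {a b}, R a b → D b < D a := by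
    rintro a b ⟨j, hj, rfl⟩
    exact hD a j hj
  have hRDs : ∀ {a b}, ReflTransGen R a b → D b ≤ D a := by
    intro a b h
    induction h with
    | refl => exact le_rfl
    | tail _ h ih => exact (hRD h).le.trans ih
  have hRu : Relator.RightUnique R := by
    rintro a b b' ⟨j, hj, rfl⟩ ⟨j', hj', rfl⟩
    rw [hj] at hj'
    rw [Sum.inl.inj hj']
  have hlivet : ∀ q, v (t q) ≠ 0 → live q := fun q h => ⟨t q, ht q, h⟩
  have hleaf : ∀ q, (∀ q', live q' → ¬ R q' q) →
      ∀ j, π j = q → (c q : ℂ) * v (σ j) = μ * v j := by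
    intro q hq j hj
    have := h1 j
    rw [Finset.sum_eq_zero, add_zero, hj] at this
    · exact this
    · intro q' _
      split_ifs with h
      · by_contra h'
        exact hq q' (hlivet q' h') ⟨j, h, hj⟩
      · rfl
  have hleafnorm : ∀ q, live q → (∀ q', live q' → ¬ R q' q) → ‖μ‖ = c q := by
    rintro q ⟨j₀, hj₀, hvj⟩ hq
    refine norm_eq_of_cycle_relation σ v (c q) (hc q) μ j₀ hvj fun j hj => hleaf q hq j ?_
    rw [← hj₀]; exact ((hπ _ _).2 hj).symm
  obtain ⟨i₀, hi₀⟩ : ∃ i, v i ≠ 0 := by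
    by_contra! h
    exact hv (funext h)
  obtain ⟨q₀, hq₀, hmax⟩ := Finset.exists_max_image (Finset.univ.filter live) D
    ⟨π i₀, by simpa using ⟨i₀, rfl, hi₀⟩⟩
  have hq₀ : live q₀ := by simpa using hq₀
  have hmax : ∀ q, live q → D q ≤ D q₀ := fun q hq => hmax q (by simpa using hq)
  have hq₀leaf : ∀ q', live q' → ¬ R q' q₀ := fun q' hq' h =>
    absurd (hRD h) (not_lt.2 (hmax q' hq'))
  have hμ : ‖μ‖ = c q₀ := hleafnorm q₀ hq₀ hq₀leaf
  have hμ0 : μ ≠ 0 := by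
    rw [← norm_pos_iff, hμ]; exact hc q₀
  have hcC : ∀ q, (c q : ℂ) ≠ 0 := fun q => by exact_mod_cast (hc q).ne'
  -- Going down through live children ends at a live cycle without live children. Its weight is
  -- `‖μ‖`, so by injectivity of `c` it is `q₀`.
  have hanc : ∀ n q, D q₀ - D q = n → live q → ReflTransGen R q₀ q := by
    intro n
    induction n using Nat.strong_induction_on with
    | _ n ih =>
      intro q hn hq
      by_cases hch : ∃ q', live q' ∧ R q' q
      · obtain ⟨q', hq', hR⟩ := hch
        refine (ih (D q₀ - D q') ?_ q' rfl hq').tail hR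
        have := hRD hR
        have := hmax q' hq'
        omega
      · push Not at hch
        have := hleafnorm q hq hch
        rw [hcinj (this.symm.trans hμ)]
  -- Parents are unique, so live cycles form a chain above `q₀`; of two distinct ones, one would be
  -- a proper ancestor of the other, which the depth conditions forbid.
  have huniq : ∀ q q', live q → live q' → (∀ b, R q b → D b < D q') →
      (∀ b, R q' b → D b < D q) → q = q' := by
    intro q q' hq hq' hb hb'
    rcases ReflTransGen.total_of_right_unique hRu (hanc _ q rfl hq) (hanc _ q' rfl hq') with h | h
    · rcases h.cases_head with rfl | ⟨b, hR, hs⟩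
      · rfl
      · exact absurd (hRDs hs) (not_le.2 (hb b hR))
    · rcases h.cases_head with rfl | ⟨b, hR, hs⟩
      · rfl
      · exact absurd (hRDs hs) (not_le.2 (hb' b hR))
  have hsib : ∀ q q' b, live q → live q' → R q b → R q' b → q = q' := by
    intro q q' b hq hq' hb hb'
    refine huniq q q' hq hq' (fun b₁ h => ?_) (fun b₁ h => ?_)
    · rw [hRu h hb]; exact hRD hb'
    · rw [hRu h hb']; exact hRD hb
  -- Nonvanishing moves up the chain: the only live child `q` of `b` contributes `v (t q) ≠ 0` at
  -- the single vertex `p` of `b`.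
  have hfull : ∀ q, ReflTransGen R q₀ q → ∀ j, π j = q → v j ≠ 0 := by
    intro q h
    induction h with
    | refl =>
      obtain ⟨j₀, hj₀, hvj⟩ := hq₀
      intro j hj
      have hst : ∀ i, π i = q₀ → v i ≠ 0 → v (σ i) ≠ 0 := by
        intro i hi hvi h0
        have := hleaf q₀ hq₀leaf i hi
        rw [h0, mul_zero] at this
        exact mul_ne_zero hμ0 hvi this.symm
      refine forall_sameCycle_of_step σ j₀ (fun i => v i ≠ 0) (hst j₀ hj₀ hvj)
        (fun i hi _ => hst i ?_) j ((hπ _ _).1 (hj₀.trans hj.symm))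
      rw [← hj₀]; exact ((hπ _ _).2 hi).symm
    | @tail q b _ hR ih =>
      obtain ⟨p, hp, hpb⟩ := hR
      have hR : R q b := ⟨p, hp, hpb⟩
      have hvt : v (t q) ≠ 0 := ih _ (ht q)
      have hsum : ∀ j, π j = b → ∑ q', (if src q' = Sum.inl j then v (t q') else 0) =
          if j = p then v (t q) else 0 := by
        intro j hj
        rw [Finset.sum_eq_single q]
        · simp [hp, eq_comm]
        · intro q' _ hne
          split_ifs with h
          · by_contra h'
            exact hne (hsib q' q b (hlivet q' h') (hlivet q hvt) ⟨j, h, hj⟩ hR)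
          · rfl
        · simp
      have hcyc : ∀ j, σ.SameCycle p j → π j = b := fun j hj => by
        rw [← hpb]; exact ((hπ _ _).2 hj).symm
      have hstep : ∀ j, σ.SameCycle p j → j ≠ p → (c b : ℂ) * v (σ j) = μ * v j := by
        intro j hj hjp
        have := h1 j
        rwa [hsum j (hcyc j hj), if_neg hjp, add_zero, hcyc j hj] at this
      -- A zero at `σ p` would travel round the whole cycle back to `p`, where the equation would
      -- leave `v (t q) = 0`.
      have hσp : v (σ p) ≠ 0 := by
        intro h0
        have hall := forall_sameCycle_of_step σ p (fun i => v i = 0) h0 (by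
          intro j hj hjp hvj
          have := hstep j hj hjp
          rw [hvj, mul_zero] at this
          exact (mul_eq_zero.1 this).resolve_left (hcC b))
        have := h1 p
        rw [hsum p hpb, if_pos rfl, h0, hall p (SameCycle.refl σ p)] at this
        simp only [mul_zero, zero_add] at this
        exact hvt this
      intro j hj
      refine forall_sameCycle_of_step σ p (fun i => v i ≠ 0) hσp ?_ j
        ((hπ _ _).1 (hpb.trans hj.symm))
      intro i hi hip hvi h0
      have := hstep i hi hip
      rw [h0, mul_zero] at this
      exact mul_ne_zero hμ0 hvi this.symm
  -- The top `r` of the chain has no parent cycle, so an input feeds it; in that input's equation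
  -- only `v (t r)` survives.
  obtain ⟨r, hr, hmin⟩ := Finset.exists_min_image (Finset.univ.filter (ReflTransGen R q₀)) D
    ⟨q₀, by simpa using ReflTransGen.refl⟩
  have hr : ReflTransGen R q₀ r := by simpa using hr
  have hrroot : ∀ b, ¬ R r b := fun b hb =>
    absurd (hRD hb) (not_lt.2 (hmin b (by simpa using hr.tail hb)))
  have hvr := hfull r hr _ (ht r)
  cases hs : src r with
  | inl p => exact hrroot _ ⟨p, hs, rfl⟩
  | inr k =>
    have := h2 k
    rw [Finset.sum_eq_single r, if_pos hs] at this
    · exact hvr this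
    · intro q' _ hne
      split_ifs with h
      · by_contra h'
        refine hne (huniq q' r (hlivet q' h') (hlivet r hvr) ?_ fun b hb => absurd hb (hrroot b))
        rintro b ⟨j, hj, -⟩
        rw [h] at hj
        cases hj
      · rfl
    · simp

/-! ### Controllability from the Kalman and eigenvector tests. -/

open MeasureTheory in
/-- The input-to-state map of a linear system is onto as soon as no nonzero functional
annihilates all the vectors `Lⁿ (b u)`. -/
theorem exists_integral_exp_eq {E : Type*} [NormedAddCommGroup E] [NormedSpace ℝ E]
    [FiniteDimensional ℝ E] {ι : Type*} [Fintype ι] (L : E →L[ℝ] E) (b : (ι → ℝ) →L[ℝ] E)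
    (h : ∀ f : E →L[ℝ] ℝ, (∀ n : ℕ, ∀ u, f ((L ^ n) (b u)) = 0) → f = 0) (y : E) :
    ∃ u : ℝ → ι → ℝ, Continuous u ∧
      ∫ s in (0 : ℝ)..1, (NormedSpace.exp (s • L)) (b (u s)) = y := by
  classical
  have : CompleteSpace E := FiniteDimensional.complete ℝ E
  have hexp : Continuous fun s : ℝ => NormedSpace.exp (s • L) :=
    continuous_iff_continuousAt.2 fun s => (hasDerivAt_exp_smul_const (𝕂 := ℝ) L s).continuousAt
  have hcont : ∀ u : ℝ → ι → ℝ, Continuous u →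
      Continuous fun s => (NormedSpace.exp (s • L)) (b (u s)) := fun u hu =>
    hexp.clm_apply (b.continuous.comp hu)
  let W : Submodule ℝ E :=
    { carrier := {y | ∃ u : ℝ → ι → ℝ, Continuous u ∧
        ∫ s in (0 : ℝ)..1, (NormedSpace.exp (s • L)) (b (u s)) = y}
      zero_mem' := ⟨fun _ => 0, continuous_const, by simp⟩
      add_mem' := by
        rintro _ _ ⟨u, hu, rfl⟩ ⟨u', hu', rfl⟩
        refine ⟨fun s => u s + u' s, hu.add hu', ?_⟩
        rw [← intervalIntegral.integral_add ((hcont u hu).intervalIntegrable _ _)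
          ((hcont u' hu').intervalIntegrable _ _)]
        simp only [map_add]
      smul_mem' := by
        rintro a _ ⟨u, hu, rfl⟩
        refine ⟨fun s => a • u s, hu.const_smul a, ?_⟩
        rw [← intervalIntegral.integral_smul]
        simp only [map_smul] }
  suffices hW : W = ⊤ by
    have : y ∈ W := hW ▸ Submodule.mem_top
    exact this
  by_contra hne
  obtain ⟨g, hg0, hg⟩ := Submodule.exists_dual_map_eq_bot_of_lt_top (lt_top_iff_ne_top.2 hne)
    inferInstance
  let f : E →L[ℝ] ℝ := LinearMap.toContinuousLinearMap g
  have hf : ∀ z ∈ W, f z = 0 := by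
    intro z hz
    have : g z ∈ W.map g := Submodule.mem_map_of_mem hz
    rw [hg] at this
    exact (Submodule.mem_bot ℝ).1 this
  -- For this input, `f` of the integral is the integral of `∑ i, u s i ^ 2`, which must vanish
  -- because `f` kills `W`.
  let u : ℝ → ι → ℝ := fun s i => f ((NormedSpace.exp (s • L)) (b (Pi.single i 1)))
  have hu : Continuous u := continuous_pi fun i =>
    f.continuous.comp (hcont (fun _ => Pi.single i 1) continuous_const)
  have hlin : ∀ s z, f ((NormedSpace.exp (s • L)) (b z)) = ∑ i, z i * u s i := by
    intro s z
    conv_lhs => rw [pi_eq_sum_univ' z]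
    simp only [map_sum, map_smul, smul_eq_mul, u]
  have hint : ∫ s in (0 : ℝ)..1, ∑ i, u s i * u s i = 0 := by
    have := hf _ ⟨u, hu, rfl⟩
    rw [← ContinuousLinearMap.intervalIntegral_comp_comm _
      ((hcont u hu).intervalIntegrable _ _)] at this
    simpa only [hlin] using this
  have hzero : ∀ s ∈ Set.Icc (0 : ℝ) 1, u s = 0 := by
    by_contra! hcon
    obtain ⟨s, hs, hus⟩ := hcon
    refine (intervalIntegral.integral_pos (a := 0) (b := 1) one_pos (f := fun s => ∑ i, u s i * u s i)
      (by fun_prop) (fun x _ => Finset.sum_nonneg fun i _ => mul_self_nonneg _)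
      ⟨s, hs, ?_⟩).ne' hint
    obtain ⟨i, hi⟩ := Function.ne_iff.1 hus
    exact Finset.sum_pos' (fun i _ => mul_self_nonneg _)
      ⟨i, Finset.mem_univ _, mul_self_pos.2 hi⟩
  -- Differentiating the vanishing identity brings down a factor `L`; derivatives within the closed
  -- interval keep `s = 0` available.
  have hder : ∀ n : ℕ, ∀ z, ∀ s ∈ Set.Icc (0 : ℝ) 1,
      f ((NormedSpace.exp (s • L)) ((L ^ n) (b z))) = 0 := by
    intro n z
    induction n with
    | zero =>
      intro s hs
      simp [hlin, hzero s hs]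
    | succ n ih =>
      intro s hs
      have hd := (((hasDerivAt_exp_smul_const (𝕂 := ℝ) L s).clm_apply
        (hasDerivAt_const s ((L ^ n) (b z)))))
      have hd' := (f.hasFDerivAt.comp_hasDerivAt s hd).hasDerivWithinAt (s := Set.Icc 0 1)
      have h0 : HasDerivWithinAt (fun _ : ℝ => (0 : ℝ)) 0 (Set.Icc 0 1) s :=
        hasDerivWithinAt_const _ _ _
      have := (uniqueDiffOn_Icc (zero_lt_one' ℝ) s hs).eq_deriv _ hd'
        (h0.congr (fun x hx => ih x hx) (ih s hs))
      simpa [pow_succ'] using this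
  have hf0 : f = 0 := h f fun n z => by simpa using hder n z 0 (by simp)
  exact hg0 (LinearMap.ext fun z => by simpa [f] using DFunLike.congr_fun hf0 z)

/-- The Kalman criterion (sufficiency): if no nonzero row vector annihilates all the matrices
`Aⁿ B`, then the system is controllable. -/
theorem controllable_of_kalman {d m : ℕ} (A : Matrix (Fin d) (Fin d) ℝ)
    (B : Matrix (Fin d) (Fin m) ℝ)
    (h : ∀ v : Fin d → ℝ, (∀ n : ℕ, Matrix.vecMul v (A ^ n * B) = 0) → v = 0) :
    Controllable A B := by
  classical
  intro x₀ x₁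
  let L : (Fin d → ℝ) →L[ℝ] (Fin d → ℝ) := LinearMap.toContinuousLinearMap A.mulVecLin
  let b : (Fin m → ℝ) →L[ℝ] (Fin d → ℝ) := LinearMap.toContinuousLinearMap B.mulVecLin
  have hL : ∀ x, L x = A.mulVec x := fun x => rfl
  have hb : ∀ x, b x = B.mulVec x := fun x => rfl
  have hLn : ∀ n : ℕ, ∀ x, (L ^ n) x = (A ^ n).mulVec x := by
    intro n
    induction n with
    | zero => intro x; simp
    | succ n ih => intro x; rw [pow_succ, pow_succ, ← Matrix.mulVec_mulVec, ← ih, ← hL]; rfl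
  -- The sign comes from variation of constants, `x t = exp (tL) (x₀ + ∫ exp (-sL) b u)`; signs of
  -- powers do not affect annihilation.
  have hsurj := exists_integral_exp_eq (-L) b (by
    intro f hf
    have hfv : ∀ x, f x = (fun i => f (Pi.single i 1)) ⬝ᵥ x := by
      intro x
      conv_lhs => rw [pi_eq_sum_univ' x]
      simp only [map_sum, map_smul, smul_eq_mul, dotProduct]
      refine Finset.sum_congr rfl fun i _ => ?_
      rw [mul_comm]
    have hv : (fun i => f (Pi.single i 1)) = 0 := by
      refine h _ fun n => ?_
      ext k
      have := hf n (Pi.single k 1)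
      rw [neg_pow] at this
      have h2 : f ((L ^ n) (b (Pi.single k 1))) = 0 := by
        rcases neg_one_pow_eq_or ((Fin d → ℝ) →L[ℝ] (Fin d → ℝ)) n with e | e <;>
          simpa [e] using this
      rw [hLn, hb, hfv, Matrix.mulVec_mulVec, Matrix.dotProduct_mulVec] at h2
      simpa using h2
    ext x
    rw [hfv, hv]
    simp)
  obtain ⟨u, hu, hint⟩ := hsurj (NormedSpace.exp (-L) x₁ - x₀)
  have hexp : Continuous fun s : ℝ => NormedSpace.exp (s • (-L)) :=
    continuous_iff_continuousAt.2 fun s => (hasDerivAt_exp_smul_const (𝕂 := ℝ) (-L) s).continuousAt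
  have hcont : Continuous fun s => (NormedSpace.exp (s • (-L))) (b (u s)) :=
    hexp.clm_apply (b.continuous.comp hu)
  have hinv : ∀ s : ℝ, ∀ z, NormedSpace.exp (s • L) (NormedSpace.exp (s • (-L)) z) = z := by
    intro s z
    have e : NormedSpace.exp (s • L) * NormedSpace.exp (s • (-L)) = 1 := by
      let _ : NormedAlgebra ℚ ((Fin d → ℝ) →L[ℝ] (Fin d → ℝ)) :=
        NormedAlgebra.restrictScalars ℚ ℝ _
      rw [← NormedSpace.exp_add_of_commute]
      · simp
      · exact ((Commute.refl L).neg_right.smul_left s).smul_right s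
    exact DFunLike.congr_fun e z
  refine ⟨1, one_pos, u, fun t => NormedSpace.exp (t • L)
    (x₀ + ∫ s in (0 : ℝ)..t, (NormedSpace.exp (s • (-L))) (b (u s))), hu.continuousOn, ?_, ?_, ?_⟩
  · intro t _
    refine HasDerivAt.hasDerivWithinAt ?_
    have h1 := (hcont.integral_hasStrictDerivAt 0 t).hasDerivAt.const_add x₀
    have h2 := (hasDerivAt_exp_smul_const' (𝕂 := ℝ) L t).clm_apply h1
    rw [hinv] at h2
    exact h2
  · simp
  · simp only [hint]
    rw [add_sub_cancel]
    simpa using hinv 1 x₁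

/-- The eigenvector test (sufficiency): if no complex left eigenvector of `A` is annihilated
by `B`, then the system is controllable. -/
theorem controllable_of_eigenvector_test {d m : ℕ} (A : Matrix (Fin d) (Fin d) ℝ)
    (B : Matrix (Fin d) (Fin m) ℝ)
    (h : ∀ (v : Fin d → ℂ) (μ : ℂ), Matrix.vecMul v (A.map (algebraMap ℝ ℂ)) = μ • v →
      Matrix.vecMul v (B.map (algebraMap ℝ ℂ)) = 0 → v = 0) :
    Controllable A B := by
  refine controllable_of_kalman A B fun v hv => ?_
  by_contra hv0
  set A' := A.map (algebraMap ℝ ℂ) with hA'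
  set B' := B.map (algebraMap ℝ ℂ) with hB'
  -- The largest `A'`-invariant space of row vectors killed by `B'`; being nonzero over `ℂ`, it
  -- contains an eigenvector.
  let W : Submodule ℂ (Fin d → ℂ) :=
    ⨅ n : ℕ, LinearMap.ker (Matrix.vecMulLinear (A' ^ n * B'))
  have hW : ∀ z, z ∈ W ↔ ∀ n : ℕ, Matrix.vecMul z (A' ^ n * B') = 0 := by
    intro z
    simp [W, Submodule.mem_iInf]
  have hinv : ∀ z ∈ W, Matrix.vecMulLinear A' z ∈ W := by
    intro z hz
    rw [hW] at hz ⊢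
    intro n
    have := hz (n + 1)
    rwa [pow_succ', Matrix.mul_assoc, ← Matrix.vecMul_vecMul] at this
  have hmem : (fun i => (v i : ℂ)) ∈ W := by
    rw [hW]
    intro n
    have hmap : A' ^ n * B' = (A ^ n * B).map (algebraMap ℝ ℂ) := by
      rw [Matrix.map_mul, Matrix.map_pow]
    ext k
    have := congrArg (algebraMap ℝ ℂ) (congrFun (hv n) k)
    rw [hmap]
    simpa [Matrix.vecMul, dotProduct] using this
  have : Nontrivial W := by
    refine ⟨⟨⟨_, hmem⟩, 0, fun he => hv0 ?_⟩⟩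
    ext i
    have := congrFun (congrArg Subtype.val he) i
    simpa using this
  obtain ⟨μ, hμ⟩ := Module.End.exists_eigenvalue ((Matrix.vecMulLinear A').restrict hinv)
  obtain ⟨z, hz⟩ := hμ.exists_hasEigenvector
  have hz1 := congrArg Subtype.val hz.apply_eq_smul
  refine hz.2 (Subtype.ext (h z.1 μ (by simpa using hz1) ?_))
  simpa using (hW z.1).1 z.2 0

/-! ### Source components and reachability. -/

section Digraph

open Relation

/-- The set of vertices from which `a` can be reached. -/
noncomputable def ancestors {V : Type*} [Fintype V] (G : Digraph V) (a : V) : Finset V := by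
  classical exact Finset.univ.filter fun b => ReflTransGen G.Adj b a

theorem mem_ancestors {V : Type*} [Fintype V] {G : Digraph V} {a b : V} :
    b ∈ ancestors G a ↔ ReflTransGen G.Adj b a := by
  simp [ancestors]

theorem IsStronglyConnectedOn.reflTransGen {V : Type*} {G : Digraph V} {S : Finset V}
    (h : IsStronglyConnectedOn G S) {a b : V} (ha : a ∈ S) (hb : b ∈ S) :
    ReflTransGen G.Adj a b :=
  (h a ha b hb).lift id fun _ _ hpq => hpq.2.2

/-- A source component is the set of ancestors of each of its vertices. -/
theorem IsSourceSCC.eq_ancestors {V : Type*} [Fintype V] {G : Digraph V} {S : Finset V}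
    (hS : IsSourceSCC G S) {a : V} (ha : a ∈ S) : S = ancestors G a := by
  ext b
  rw [mem_ancestors]
  refine ⟨fun hb => hS.1.1.2.reflTransGen hb ha, fun hb => ?_⟩
  induction hb using ReflTransGen.head_induction_on with
  | refl => exact ha
  | head hadj _ ih =>
    by_contra hb
    exact hS.2 _ hb _ ih hadj

theorem IsSourceSCC.eq_of_mem {V : Type*} [Fintype V] {G : Digraph V} {S T : Finset V}
    (hS : IsSourceSCC G S) (hT : IsSourceSCC G T) {a : V} (haS : a ∈ S) (haT : a ∈ T) : S = T :=
  (hS.eq_ancestors haS).trans (hT.eq_ancestors haT).symm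

/-- Every vertex of a finite digraph can be reached from a source component. -/
theorem exists_isSourceSCC_reflTransGen {V : Type*} [Fintype V] (G : Digraph V) (i : V) :
    ∃ S, IsSourceSCC G S ∧ ∀ a ∈ S, ReflTransGen G.Adj a i := by
  -- An ancestor `j` of `i` with fewest ancestors: each ancestor of `j` then has the same ancestor
  -- set, hence is reachable from `j`.
  obtain ⟨j, hj, hmin⟩ := Finset.exists_min_image (ancestors G i)
    (fun j => (ancestors G j).card) ⟨i, mem_ancestors.2 ReflTransGen.refl⟩
  rw [mem_ancestors] at hj
  have hback : ∀ a ∈ ancestors G j, ReflTransGen G.Adj j a := by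
    intro a ha
    have hsub : ancestors G a ⊆ ancestors G j := fun b hb =>
      mem_ancestors.2 ((mem_ancestors.1 hb).trans (mem_ancestors.1 ha))
    have heq := Finset.eq_of_subset_of_card_le hsub
      (hmin a (mem_ancestors.2 ((mem_ancestors.1 ha).trans hj)))
    rw [← mem_ancestors, heq]
    exact mem_ancestors.2 ReflTransGen.refl
  have hclosed : ∀ a b, b ∈ ancestors G j → G.Adj a b → a ∈ ancestors G j := fun a b hb hab =>
    mem_ancestors.2 ((mem_ancestors.1 hb).head hab)
  refine ⟨ancestors G j, ⟨⟨⟨⟨j, mem_ancestors.2 ReflTransGen.refl⟩, ?_⟩, ?_⟩, ?_⟩, ?_⟩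
  · intro a ha b hb
    have hab : ReflTransGen G.Adj a b := (mem_ancestors.1 ha).trans (hback b hb)
    clear ha
    have : b ∈ ancestors G j → a ∈ ancestors G j ∧
        ReflTransGen (fun p q => p ∈ ancestors G j ∧ q ∈ ancestors G j ∧ G.Adj p q) a b := by
      intro hb
      induction hab using ReflTransGen.head_induction_on with
      | refl => exact ⟨hb, ReflTransGen.refl⟩
      | head hadj _ ih =>
        have h := hclosed _ _ ih.1 hadj
        exact ⟨h, ih.2.head ⟨h, ih.1, hadj⟩⟩
    exact (this hb).2
  · intro T hT hle t ht
    exact mem_ancestors.2 (hT.2.reflTransGen ht (hle (mem_ancestors.2 ReflTransGen.refl)))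
  · intro a ha b hb hab
    exact ha (hclosed a b hb hab)
  · intro a ha
    exact (mem_ancestors.1 ha).trans hj

end Digraph

/-! ### Necessity: every source component needs an input. -/

/-- If no state outside `S` and no input acts on the states of `S`, then the states of `S` stay
at zero. -/
theorem IsTrajectory.eq_zero_of_isolated {d m : ℕ} {A : Matrix (Fin d) (Fin d) ℝ}
    {B : Matrix (Fin d) (Fin m) ℝ} {T : ℝ} {u : ℝ → Fin m → ℝ} {x : ℝ → Fin d → ℝ}
    (hx : IsTrajectory A B T u x) (S : Finset (Fin d))
    (hA : ∀ i ∈ S, ∀ j ∉ S, A i j = 0) (hB : ∀ i ∈ S, ∀ k, B i k = 0) (hx0 : x 0 = 0) :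
    ∀ t ∈ Set.Icc 0 T, ∀ i ∈ S, x t i = 0 := by
  classical
  -- Coordinate projection onto `S`. By isolation `P x` solves the autonomous equation `y' = P L y`,
  -- and Grönwall's inequality forces it to stay zero.
  let P : (Fin d → ℝ) →L[ℝ] (Fin d → ℝ) :=
    ContinuousLinearMap.pi fun i => if i ∈ S then ContinuousLinearMap.proj i else 0
  have hP : ∀ z i, P z i = if i ∈ S then z i else 0 := by
    intro z i
    simp only [P, ContinuousLinearMap.coe_pi']
    split_ifs <;> simp
  let L : (Fin d → ℝ) →L[ℝ] (Fin d → ℝ) := LinearMap.toContinuousLinearMap A.mulVecLin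
  have hPL : ∀ z y, P (A.mulVec z + B.mulVec y) = (P ∘L L) (P z) := by
    intro z y
    ext i
    change _ = P (A.mulVec (P z)) i
    rw [hP, hP]
    split_ifs with hi
    · have hb : B.mulVec y i = 0 := by
        simp [Matrix.mulVec, dotProduct, hB i hi]
      rw [Pi.add_apply, hb, add_zero, Matrix.mulVec, Matrix.mulVec, dotProduct, dotProduct]
      refine Finset.sum_congr rfl fun j _ => ?_
      rw [hP]
      split_ifs with hj
      · rfl
      · rw [hA i hi j hj]; simp
    · rfl
  have hder : ∀ t ∈ Set.Icc 0 T,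
      HasDerivWithinAt (fun t => P (x t)) ((P ∘L L) (P (x t))) (Set.Icc 0 T) t := by
    intro t ht
    rw [← hPL _ (u t)]
    exact P.hasFDerivAt.comp_hasDerivWithinAt t (hx t ht)
  have hzero := eq_zero_of_abs_deriv_le_mul_abs_self_of_eq_zero_right
    (f := fun t => P (x t)) (f' := fun t => (P ∘L L) (P (x t))) (K := ‖P ∘L L‖) (a := 0) (b := T)
    (fun t ht => (hder t ht).continuousWithinAt)
    (fun t ht => (hder t (Set.Ico_subset_Icc_self ht)).mono_of_mem_nhdsWithin
      (Icc_mem_nhdsGE_of_mem ht))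
    (by simp [hx0]) (fun t _ => (P ∘L L).le_opNorm _)
  intro t ht i hi
  have := congrFun (hzero t ht) i
  simpa [hP, hi] using this

/-- In a structurally controllable pair, each source component receives an input. -/
theorem StructurallyControllable.exists_input {d m : ℕ} {A : Sparsity d d} {N : Sparsity d m}
    (h : StructurallyControllable A N) {S : Finset (Fin d)}
    (hS : IsSourceSCC (stateDigraph A) S) : ∃ i ∈ S, ∃ k, N i k = true := by
  by_contra! hcon
  obtain ⟨RA, RB, hRA, hRB, hc⟩ := h
  obtain ⟨i, hi⟩ := hS.1.1.1
  obtain ⟨T, hT, u, x, -, hx, hx0, hx1⟩ := hc 0 (fun _ => 1)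
  have := hx.eq_zero_of_isolated S
    (fun i hi j hj => hRA i j (by simpa [stateDigraph] using hS.2 j hj i hi))
    (fun i hi k => hRB i k (by simpa using hcon i hi k)) hx0 T ⟨hT.le, le_rfl⟩ i hi
  rw [hx1] at this
  exact one_ne_zero this

/-! ### Sufficiency: a controllable realization built from the matching. -/

/-- A perfect matching of `Γ(A)` is a permutation of the states along the edges of `G(A)`. -/
theorem HasPerfectMatching.exists_perm {d : ℕ} {A : Sparsity d d} (h : HasPerfectMatching A) :
    ∃ σ : Equiv.Perm (Fin d), ∀ j, A (σ j) j = true := by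
  obtain ⟨M, hM⟩ := h
  rw [SimpleGraph.Subgraph.isPerfectMatching_iff] at hM
  have key : ∀ j, ∃ i, A i j = true ∧ M.Adj (Sum.inl j) (Sum.inr i) := by
    intro j
    obtain ⟨w, hw, -⟩ := hM (Sum.inl j)
    have hadj := hw.adj_sub
    simp only [bipartiteGraph, SimpleGraph.fromRel_adj] at hadj
    rcases hadj.2 with ⟨i, j', hA, hj, rfl⟩ | ⟨i, j', -, -, hj⟩
    · cases hj
      exact ⟨i, hA, hw⟩
    · cases hj
  choose f hfA hfM using key
  have hinj : Function.Injective f := by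
    intro j j' hjj
    have h1 := (hfM j).symm
    have h2 := (hfM j').symm
    rw [← hjj] at h2
    exact Sum.inl.inj ((hM (Sum.inr (f j))).unique h1 h2)
  exact ⟨Equiv.ofBijective f (Finite.injective_iff_bijective.1 hinj), hfA⟩

/-- If `G(A)` is covered by disjoint cycles and each source component receives an input, then the
pair is structurally controllable. -/
theorem structurallyControllable_of_input {d m : ℕ} {A : Sparsity d d} {N : Sparsity d m}
    (hA : HasPerfectMatching A)
    (hN : ∀ S, IsSourceSCC (stateDigraph A) S → ∃ i ∈ S, ∃ k, N i k = true) :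
    StructurallyControllable A N := by
  classical
  obtain ⟨σ, hσ⟩ := hA.exists_perm
  let Q := Quotient (Equiv.Perm.SameCycle.setoid σ)
  let π : Fin d → Q := Quotient.mk _
  have hπ : ∀ i j, π i = π j ↔ σ.SameCycle i j := fun i j => Quotient.eq
  -- `reach n q`: some chain of `n` edges between cycles leads from a fed cycle to `q`. The least
  -- such `n` is the depth `D q`, and a shortest chain supplies the parent.
  let reach : ℕ → Q → Prop := fun n => Nat.rec (fun q => ∃ i, π i = q ∧ ∃ k, N i k = true)
    (fun _ R q => ∃ i, π i = q ∧ ∃ j, A i j = true ∧ R (π j)) n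
  have hreach : ∀ q, ∃ n, reach n q := by
    intro q
    obtain ⟨i, rfl⟩ := Quotient.exists_rep q
    obtain ⟨S, hS, hSi⟩ := exists_isSourceSCC_reflTransGen (stateDigraph A) i
    obtain ⟨a, ha, k, hk⟩ := hN S hS
    have hai := hSi a ha
    clear hSi
    induction hai with
    | refl => exact ⟨0, a, rfl, k, hk⟩
    | tail _ hadj ih =>
      obtain ⟨n, hn⟩ := ih
      exact ⟨n + 1, _, rfl, _, hadj, hn⟩
  obtain ⟨D, hDreach, hDle⟩ : ∃ D : Q → ℕ, (∀ q, reach (D q) q) ∧ ∀ q n, reach n q → D q ≤ n :=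
    ⟨fun q => sInf {n | reach n q}, fun q => Nat.sInf_mem (hreach q), fun _ _ h => Nat.sInf_le h⟩
  have hsrc : ∀ q, ∃ (i : Fin d) (s : Fin d ⊕ Fin m), π i = q ∧
      (∀ p, s = Sum.inl p → A i p = true ∧ D (π p) < D q) ∧
      (∀ k, s = Sum.inr k → N i k = true) := by
    intro q
    have hq : reach (D q) q := hDreach q
    cases hn : D q with
    | zero =>
      rw [hn] at hq
      obtain ⟨i, hi, k, hk⟩ := hq
      exact ⟨i, Sum.inr k, hi, by simp, by rintro _ ⟨⟩; exact hk⟩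
    | succ n =>
      rw [hn] at hq
      obtain ⟨i, hi, j, hj, hr⟩ := hq
      refine ⟨i, Sum.inl j, hi, ?_, by simp⟩
      rintro _ ⟨⟩
      exact ⟨hj, Nat.lt_succ_of_le (hDle _ _ hr)⟩
  choose t src ht hinl hinr using hsrc
  let e := Fintype.equivFin Q
  let c : Q → ℝ := fun q => ((e q : ℕ) : ℝ) + 1
  have hc : ∀ q, 0 < c q := fun q => by positivity
  have hcinj : Function.Injective c := by
    intro q q' h
    simpa [c, Fin.val_inj] using h
  -- Weight `c q` on the edges of the cycle `q`, plus 1 on the entering edge `src q → t q` of each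
  -- cycle.
  refine ⟨fun i j => (if i = σ j then c (π j) else 0) +
      ∑ q, if t q = i ∧ src q = Sum.inl j then 1 else 0,
    fun i k => ∑ q, if t q = i ∧ src q = Sum.inr k then 1 else 0, ?_, ?_, ?_⟩
  · intro i j hij
    beta_reduce
    rw [if_neg, Finset.sum_eq_zero, add_zero]
    · intro q _
      rw [if_neg]
      rintro ⟨rfl, hs⟩
      rw [(hinl q j hs).1] at hij
      cases hij
    · rintro rfl
      rw [hσ] at hij
      cases hij
  · intro i k hik
    refine Finset.sum_eq_zero fun q _ => if_neg ?_
    rintro ⟨rfl, hs⟩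
    rw [hinr q k hs] at hik
    cases hik
  · have hsum : ∀ (v : Fin d → ℂ) (s : Fin d ⊕ Fin m),
        ∑ i, v i * ((∑ q, if t q = i ∧ src q = s then 1 else 0 : ℝ) : ℂ) =
          ∑ q, if src q = s then v (t q) else 0 := by
      intro v s
      push_cast
      simp only [Finset.mul_sum]
      rw [Finset.sum_comm]
      refine Finset.sum_congr rfl fun q _ => ?_
      rw [Finset.sum_eq_single (t q)]
      · by_cases hs : src q = s <;> simp [hs]
      · intro i _ hi
        simp [hi.symm]
      · simp
    refine controllable_of_eigenvector_test _ _ fun v μ h1 h2 => ?_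
    refine eq_zero_of_forest_eigenvector σ π hπ c hc hcinj D t ht src
      (fun q p hs => (hinl q p hs).2) v μ (fun j => ?_) (fun k => ?_)
    · have hj : ∑ i, v i * (((if i = σ j then c (π j) else 0) +
          ∑ q, if t q = i ∧ src q = Sum.inl j then 1 else 0 : ℝ) : ℂ) = μ * v j := congrFun h1 j
      simp only [Complex.ofReal_add, mul_add, Finset.sum_add_distrib] at hj
      rw [← hj, ← hsum]
      congr 1
      rw [Finset.sum_eq_single (σ j)]
      · simp [mul_comm]
      · intro i _ hi
        simp [hi]
      · simp
    · rw [← hsum]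
      exact congrFun h2 k

/-! ### The greedy algorithm and its optimality. -/

/-- Treats `nnzCount` (`f = 1`) and `totalCost` (`f = w`) together; pairs in `L` are (input, state),
hence the swap. -/
theorem sum_entries_eq_sum {d m : ℕ} {M : Type*} [AddCommMonoid M] {N : Sparsity d m}
    {L : Finset (Fin m × Fin d)} (h : ∀ l k, N l k = true ↔ (k, l) ∈ L) (f : Fin d → Fin m → M) :
    (∑ i, ∑ j, if N i j = true then f i j else 0) = ∑ p ∈ L, f p.2 p.1 := by
  classical
  rw [Finset.sum_comm, ← Fintype.sum_prod_type' fun j i => if N i j = true then f i j else 0]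
  simp only [h]
  rw [← Finset.sum_filter]
  simp

/-- The loop selects a connection for each component it visits. -/
theorem LoopRun.exists_selects {d m : ℕ} {B : Sparsity d m} {w : Matrix (Fin d) (Fin m) ℝ}
    {comps : List (Finset (Fin d))} {L L₂ : Finset (Fin m × Fin d)}
    (h : LoopRun B w comps L L₂) :
    L ⊆ L₂ ∧ L₂.card ≤ L.card + comps.length ∧
      ∀ S ∈ comps, ∃ p ∈ L₂, Selects B w S p.1 p.2 := by
  induction h with
  | done L => simp
  | step S comps k l L L₂ hsel hrun ih =>
    obtain ⟨hsub, hcard, hall⟩ := ih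
    refine ⟨(Finset.subset_insert _ _).trans hsub, ?_, ?_⟩
    · have := Finset.card_insert_le (k, l) L
      simp only [List.length_cons]
      omega
    · intro T hT
      rcases List.mem_cons.1 hT with rfl | hT
      · exact ⟨(k, l), hsub (Finset.mem_insert_self _ _), hsel⟩
      · exact hall T hT

theorem exists_loopRun {d m : ℕ} {B : Sparsity d m} {w : Matrix (Fin d) (Fin m) ℝ}
    (comps : List (Finset (Fin d))) (h : ∀ S ∈ comps, ∃ k l, Selects B w S k l)
    (L : Finset (Fin m × Fin d)) : ∃ L₂, LoopRun B w comps L L₂ := by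
  induction comps generalizing L with
  | nil => exact ⟨L, LoopRun.done L⟩
  | cons S comps ih =>
    obtain ⟨k, l, hsel⟩ := h S (List.mem_cons_self ..)
    obtain ⟨L₂, hL₂⟩ := ih (fun T hT => h T (List.mem_cons_of_mem _ hT)) (insert (k, l) L)
    exact ⟨L₂, LoopRun.step S comps k l L L₂ hsel hL₂⟩

theorem exists_selects {d m : ℕ} [Nonempty (Fin m)] (B : Sparsity d m)
    (w : Matrix (Fin d) (Fin m) ℝ) {S : Finset (Fin d)} (hS : S.Nonempty) :
    ∃ k l, Selects B w S k l := by
  choose best hbest using fun i => Finite.exists_min (extCost B w i)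
  obtain ⟨l, hl, hmin⟩ := Finset.exists_min_image S (fun i => extCost B w i (best i)) hS
  exact ⟨best l, l, best, fun i _ => hbest i, hl, hmin, rfl⟩

/-- A selected connection is present in `B` and is a cheapest one, provided that the component
receives an input at all. -/
theorem Selects.spec {d m : ℕ} {B : Sparsity d m} {w : Matrix (Fin d) (Fin m) ℝ}
    {S : Finset (Fin d)} {k : Fin m} {l : Fin d} (h : Selects B w S k l)
    (hS : ∃ i ∈ S, ∃ k, B i k = true) :
    l ∈ S ∧ B l k = true ∧ ∀ i ∈ S, ∀ k₂, B i k₂ = true → w l k ≤ w i k₂ := by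
  obtain ⟨best, hbest, hl, hmin, rfl⟩ := h
  have hle : ∀ i ∈ S, ∀ k₂, extCost B w l (best l) ≤ extCost B w i k₂ := fun i hi k₂ =>
    (hmin i hi).trans (hbest i hi k₂)
  have hB : B l (best l) = true := by
    by_contra hB
    obtain ⟨i, hi, k₂, hk₂⟩ := hS
    have := hle i hi k₂
    simp [extCost, hB, hk₂] at this
  refine ⟨hl, hB, fun i hi k₂ hk₂ => ?_⟩
  simpa [extCost, hB, hk₂] using hle i hi k₂

/-- Each possible output of the algorithm consists of one cheapest connection for each
source component. -/
theorem IsAlgorithmOutput.exists_selection {d m : ℕ} {A : Sparsity d d} {B : Sparsity d m}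
    {w : Matrix (Fin d) (Fin m) ℝ} {N : Sparsity d m} (h : IsAlgorithmOutput A B w N)
    (hAB : StructurallyControllable A B) :
    ∃ g : {S // IsSourceSCC (stateDigraph A) S} → Fin m × Fin d, Function.Injective g ∧
      (∀ S, (g S).2 ∈ S.1 ∧ B (g S).2 (g S).1 = true ∧
        ∀ i ∈ S.1, ∀ k, B i k = true → w (g S).2 (g S).1 ≤ w i k) ∧
      ∀ l k, N l k = true ↔ ∃ S, g S = (k, l) := by
  classical
  obtain ⟨comps, L, hnd, hmem, hrun, hNL⟩ := h
  obtain ⟨-, hcard, hsel⟩ := hrun.exists_selects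
  choose g hgL hg using fun S : {S // IsSourceSCC (stateDigraph A) S} =>
    hsel S.1 ((hmem S.1).2 S.2)
  have hspec := fun S => (hg S).spec (hAB.exists_input S.2)
  have hinj : Function.Injective g := by
    intro S T hST
    have hT := (hspec T).1
    rw [← hST] at hT
    exact Subtype.ext (S.2.eq_of_mem T.2 (hspec S).1 hT)
  refine ⟨g, hinj, hspec, fun l k => ?_⟩
  have hlen : comps.length = Fintype.card {S // IsSourceSCC (stateDigraph A) S} := by
    rw [← List.toFinset_card_of_nodup hnd]
    exact (Fintype.card_of_subtype _ fun S => by simp [hmem]).symm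
  -- The loop adds at most one pair per component and `g` already gives that many distinct pairs, so
  -- `L` contains nothing else.
  have himg : Finset.univ.image g = L := by
    refine Finset.eq_of_subset_of_card_le (fun p hp => ?_) ?_
    · obtain ⟨S, -, rfl⟩ := Finset.mem_image.1 hp
      exact hgL S
    · rw [Finset.card_image_of_injective _ hinj, Finset.card_univ, ← hlen]
      simpa using hcard
  rw [hNL, ← himg]
  simp

theorem exists_isAlgorithmOutput {d m : ℕ} {A : Sparsity d d} {B : Sparsity d m}
    (w : Matrix (Fin d) (Fin m) ℝ) (hAB : StructurallyControllable A B) :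
    ∃ N, IsAlgorithmOutput A B w N := by
  classical
  let F : Finset (Finset (Fin d)) := Finset.univ.filter (IsSourceSCC (stateDigraph A))
  have hF : ∀ S, S ∈ F.toList ↔ IsSourceSCC (stateDigraph A) S := by simp [F]
  -- Choosing a cheapest input requires `Fin m` to be nonempty; any source component supplies an
  -- input.
  obtain ⟨L, hL⟩ := exists_loopRun (B := B) (w := w) F.toList (fun S hS => by
    have hS := (hF S).1 hS
    obtain ⟨_, _, k, _⟩ := hAB.exists_input hS
    have : Nonempty (Fin m) := ⟨k⟩
    exact exists_selects B w hS.1.1.1) ∅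
  exact ⟨fun l k => decide ((k, l) ∈ L), F.toList, L, F.nodup_toList, hF, hL, by simp⟩

/-- With a perfect matching, each output of the algorithm is a cheapest sparsest admissible
input matrix. -/
theorem IsAlgorithmOutput.solvesP2 {d m : ℕ} {A : Sparsity d d} {B : Sparsity d m}
    {w : Matrix (Fin d) (Fin m) ℝ} {N : Sparsity d m} (h : IsAlgorithmOutput A B w N)
    (hw : ∀ i k, B i k = true → 0 ≤ w i k) (hAB : StructurallyControllable A B)
    (hA : HasPerfectMatching A) : StructurallyControllable A N ∧ SolvesP2 A B w N := by
  classical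
  obtain ⟨g, hginj, hg, hN⟩ := h.exists_selection hAB
  have hctrl : StructurallyControllable A N := structurallyControllable_of_input hA fun S hS =>
    ⟨_, (hg ⟨S, hS⟩).1, _, (hN _ _).2 ⟨⟨S, hS⟩, rfl⟩⟩
  have hNB : ∀ i j, B i j = false → N i j = false := by
    intro i j hB
    rw [← Bool.not_eq_true, hN]
    rintro ⟨S, hS⟩
    have := (hg S).2.1
    rw [hS, hB] at this
    cases this
  have hNL : ∀ l k, N l k = true ↔ (k, l) ∈ Finset.univ.image g := by simpa using hN
  -- Both lower bounds come from this injection of the source components into the support of `N₂`.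
  have hselect : ∀ N₂ ∈ admissible A B,
      ∃ f : {S // IsSourceSCC (stateDigraph A) S} → Fin m × Fin d, Function.Injective f ∧
        ∀ S, (f S).2 ∈ S.1 ∧ N₂ (f S).2 (f S).1 = true := by
    intro N₂ hN₂
    choose i hi k hk using fun S : {S // IsSourceSCC (stateDigraph A) S} =>
      hN₂.2.exists_input S.2
    refine ⟨fun S => (k S, i S), fun S T hST => Subtype.ext ?_, fun S => ⟨hi S, hk S⟩⟩
    refine S.2.eq_of_mem T.2 (hi S) ?_
    rw [(Prod.mk.inj hST).2]
    exact hi T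
  have hsupp : ∀ (N₂ : Sparsity d m) l k, N₂ l k = true ↔
      (k, l) ∈ Finset.univ.filter fun p : Fin m × Fin d => N₂ p.2 p.1 = true := by simp
  refine ⟨hctrl, ⟨⟨hNB, hctrl⟩, fun N₂ hN₂ => ?_⟩, fun N₂ hN₂ => ?_⟩
  · obtain ⟨f, hfinj, hf⟩ := hselect N₂ hN₂
    rw [nnzCount, nnzCount, sum_entries_eq_sum hNL, sum_entries_eq_sum (hsupp N₂),
      ← Finset.card_eq_sum_ones, ← Finset.card_eq_sum_ones,
      Finset.card_image_of_injective _ hginj, ← Finset.card_image_of_injective _ hfinj]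
    refine Finset.card_le_card fun p hp => ?_
    obtain ⟨S, -, rfl⟩ := Finset.mem_image.1 hp
    simpa using (hf S).2
  · obtain ⟨f, hfinj, hf⟩ := hselect N₂ hN₂.1
    have hN₂B : ∀ i j, N₂ i j = true → B i j = true := by
      intro i j hij
      by_contra hB
      rw [hN₂.1.1 i j (by simpa using hB)] at hij
      cases hij
    have hcost : totalCost w N = _ := sum_entries_eq_sum hNL w
    have hcost₂ : totalCost w N₂ = _ := sum_entries_eq_sum (hsupp N₂) w
    rw [hcost, hcost₂, Finset.sum_image hginj.injOn]
    calc ∑ S, w (g S).2 (g S).1 ≤ ∑ S, w (f S).2 (f S).1 :=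
          Finset.sum_le_sum fun S _ => (hg S).2.2 _ (hf S).1 _ (hN₂B _ _ (hf S).2)
      _ = ∑ p ∈ Finset.univ.image f, w p.2 p.1 := by
        rw [Finset.sum_image hfinj.injOn]
      _ ≤ _ := by
        -- Entries of `N₂` outside the image of `f` lie in the support of `B`, so their costs are
        -- nonnegative.
        refine Finset.sum_le_sum_of_subset_of_nonneg (fun p hp => ?_) (fun p hp _ => ?_)
        · obtain ⟨S, -, rfl⟩ := Finset.mem_image.1 hp
          simpa using (hf S).2
        · exact hw _ _ (hN₂B _ _ (by simpa using hp))

end StructuralControl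

theorem mainTheorem1 {d m : ℕ} (A : StructuralControl.Sparsity d d)
    (B : StructuralControl.Sparsity d m) (w : Matrix (Fin d) (Fin m) ℝ)
    (hw : ∀ i k, B i k = true → 0 ≤ w i k)
    (hAB : StructuralControl.StructurallyControllable A B)
    (hA : StructuralControl.HasPerfectMatching A) :
    (∃ Bstar, StructuralControl.IsAlgorithmOutput A B w Bstar) ∧
      ∀ Bstar, StructuralControl.IsAlgorithmOutput A B w Bstar →
        StructuralControl.StructurallyControllable A Bstar ∧
          StructuralControl.SolvesP2 A B w Bstar := by
  exact ⟨StructuralControl.exists_isAlgorithmOutput w hAB,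
    fun _ h => h.solvesP2 hw hAB hA⟩
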